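/- Let $\mathcal M$ be a connected smooth $D$-dimensional Riemannian manifold with Riemannian distance $d$ (the infimum of the lengths of curves joining two points), and let $\|\cdot\|_x$ denote the norm on $T_x\mathcal M$. Let $R$ be a retraction on $\mathcal M$: a smooth map into $\mathcal M$ defined on an open neighbourhood of the zero section of $T\mathcal M$ such that $R_x:=R(x,\cdot)$ satisfies $R_x(0)=x$ and $\mathrm D R_x(0)=\mathrm{Id}_{T_x\mathcal M}$ for every $x\in\mathcal M$. Let $\Delta:\mathcal M\to(0,\infty]$ be a continuous function such that $R$ is defined on $\mathcal T:=\{(x,v)\in T\mathcal M:\|v\|_x<\Delta(x)\}$ and $E(x,v):=(x,R_x(v))$ is a diffeomorphism from $\mathcal T$ onto an open subset of $\mathcal M\times\mathcal M$. For $(x,y)\in E(\mathcal T)$ let $R_x^{-1}(y)$ denote the unique $v\in T_x\mathcal M$ with $\|v\|_x<\Delta(x)$ and $R_x(v)=y$. (a) For every $x\in\mathcal M$ with $\Delta(x)<\infty$ there exist constants $L_R(x)>0$ and $M_R(x)>0$ such that (i) for all $u,v\in T_x\mathcal M$ with $\|u\|_x,\|v\|_x<\Delta(x)/3$, $$d(R_x(u),R_x(v))\le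 L_R(x)\,\|u-v\|_x;$$ (ii) for all $y,z\in\{R_x(w): w\in T_x\mathcal M,\ \|w\|_x<\Delta(x)/3\}$, $$\|R_x^{-1}(y)-R_x^{-1}(z)\|_x\le M_R(x)\,d(y,z).$$ (b) For every compact set $K\subset\mathcal M$ on which $\Delta$ is finite there exist constants $L_R(K)>0$ and $M_R(K)>0$ such that, for every $x\in K$, (i) and (ii) hold with $L_R(K)$ and $M_R(K)$ in place of $L_R(x)$ and $M_R(x)$. -/

import Mathlib

open Set Manifold Bundle
open scoped ContDiff ENNReal Topology

noncomputable section

section RetractionDefs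

variable {D : ℕ} {M : Type*} [MetricSpace M] [ChartedSpace (EuclideanSpace ℝ (Fin D)) M]
  [IsManifold (𝓡 D) ∞ M] [RiemannianBundle (fun x : M => TangentSpace (𝓡 D) x)]

variable (D M) in
/-- A retraction on the `D`-dimensional manifold `M`: a smooth map `R` into `M`, defined on an open
neighbourhood `dom` of the zero section of the tangent bundle, such that `R_x(0) = x` and
`D R_x(0)` is the identity of `T_x M`. The values of `toFun` outside `dom` are irrelevant. -/
structure Retraction where
  /-- The underlying function; `R_x(v)` is `toFun ⟨x, v⟩`. -/
  toFun : TangentBundle (𝓡 D) M → M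
  /-- The domain of definition. -/
  dom : Set (TangentBundle (𝓡 D) M)
  isOpen_dom : IsOpen dom
  zero_mem_dom : ∀ x : M, (⟨x, 0⟩ : TangentBundle (𝓡 D) M) ∈ dom
  smooth : ContMDiffOn (𝓡 D).tangent (𝓡 D) ∞ toFun dom
  map_zero : ∀ x : M, toFun ⟨x, 0⟩ = x
  /-- Local rigidity `D R_x(0)[v] = v`, as an equality in the tangent bundle. -/
  rigid : ∀ (x : M) (v : TangentSpace (𝓡 D) x),
    (⟨toFun ⟨x, 0⟩,
      mfderiv 𝓘(ℝ, TangentSpace (𝓡 D) x) (𝓡 D)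
        (fun w : TangentSpace (𝓡 D) x => toFun ⟨x, w⟩) 0 v⟩ : TangentBundle (𝓡 D) M) = ⟨x, v⟩

/-- The restriction `R_x` of the retraction to `T_x M`. -/
def Retraction.at (R : Retraction D M) (x : M) (v : TangentSpace (𝓡 D) x) : M :=
  R.toFun ⟨x, v⟩

/-- The map `E(x, v) = (x, R_x(v))`. -/
def Retraction.pairMap (R : Retraction D M) (p : TangentBundle (𝓡 D) M) : M × M :=
  (p.proj, R.toFun p)

/-- The set of all `(x, v)` in the tangent bundle with `‖v‖_x < Δ(x)`. -/
def tangentTube (Δ : M → ℝ≥0∞) : Set (TangentBundle (𝓡 D) M) :=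
  {p | ‖(p.2 : TangentSpace (𝓡 D) p.proj)‖ₑ < Δ p.proj}

/-- The ball of radius `r` centred at the origin of `T_x M`, in the norm of the metric. -/
def tangentBall (D : ℕ) {M : Type*} [MetricSpace M] [ChartedSpace (EuclideanSpace ℝ (Fin D)) M]
    [IsManifold (𝓡 D) ∞ M] [RiemannianBundle (fun x : M => TangentSpace (𝓡 D) x)]
    (x : M) (r : ℝ≥0∞) : Set (TangentSpace (𝓡 D) x) :=
  {v | ‖v‖ₑ < r}

/-- `Δ : M → (0, ∞]` is continuous and `E(x, v) = (x, R_x(v))` is a diffeomorphism from the set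
of all `(x, v)` with `‖v‖_x < Δ(x)`, on which `R` is defined, onto an open subset of `M × M`. -/
structure Retraction.IsInvertibilityRadius (R : Retraction D M) (Δ : M → ℝ≥0∞) : Prop where
  continuous : Continuous Δ
  pos : ∀ x, 0 < Δ x
  subset_dom : tangentTube Δ ⊆ R.dom
  diffeo : ∃ Φ : PartialDiffeomorph (𝓡 D).tangent ((𝓡 D).prod (𝓡 D))
      (TangentBundle (𝓡 D) M) (M × M) ∞,
    Φ.source = tangentTube Δ ∧ EqOn Φ R.pairMap (tangentTube Δ)

/-- The inverse retraction `R_x⁻¹(y)`: the vector `v` with `‖v‖_x < Δ(x)` and `R_x(v) = y` (unique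
if `Δ` is an invertibility radius; an arbitrary vector if there is none). -/
def Retraction.inv (R : Retraction D M) (Δ : M → ℝ≥0∞) (x y : M) : TangentSpace (𝓡 D) x :=
  Function.invFunOn (R.at x) (tangentBall D x (Δ x)) y

end RetractionDefs

end

/-! ### Riemannian distance compared with chart distance near a point. -/

section ChartDistance

open Filter MeasureTheory Metric
open scoped NNReal

variable {E : Type*} [NormedAddCommGroup E] [NormedSpace ℝ E]
  {H : Type*} [TopologicalSpace H] {I : ModelWithCorners ℝ E H}
  {M : Type*}

/-! Both estimates say that `R` is bilipschitz on the fibres of the closed tube S of all (x, v) with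
x in K and ‖v‖ ≤ Δ(x)/3. Since Δ is continuous and finite on K, S is compact
(`IsCompact.tangentBundle_tube`), and it lies in the open tube because Δ/3 < Δ there. Part (a) is
the case K = {x}.

On a compact set it suffices to find constants near each pair (p, q) in S × S; this is
`PartialDiffeomorph.exists_fiberwise_bilipschitz`. If p and q have different base points, no nearby
pair shares a fibre. If they are distinct in one fibre, injectivity of E gives R(p) ≠ R(q), so both
distances are positive at (p, q) and comparable nearby by continuity. If p = q, the upper bound
holds because R is C^1, and the lower one because E has a C^1 inverse: for a fixed base point, the
distance between (x, y) and (x, z) is only that between y and z.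

The diagonal case is computed in charts. There C^1 maps are locally Lipschitz, Riemannian distance
is comparable with chart distance, and the norm on the fibres is comparable with the norm in a
trivialization. Separating off the diagonal removes any need to keep curves from y to z inside the
image of the retraction. -/

/-- Near any point `x`, the derivative of the extended chart at `x` is bounded for the Riemannian
norm. -/
lemma eventually_enorm_mfderiv_extChartAt_apply_le [TopologicalSpace M] [ChartedSpace H M]
    [RiemannianBundle (fun x : M => TangentSpace I x)] [IsManifold I 1 M]
    [IsContinuousRiemannianBundle E (fun x : M => TangentSpace I x)] (x : M) :
    ∃ C : ℝ≥0, ∀ᶠ y in 𝓝 x, ∀ v : TangentSpace I y,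
      enorm (E := E) (mfderiv I 𝓘(ℝ, E) (extChartAt I x) y v) ≤ C * ‖v‖ₑ := by
  obtain ⟨C, C_pos, hC⟩ := eventually_norm_trivializationAt_lt E (fun x : M => TangentSpace I x) x
  lift C to ℝ≥0 using C_pos.le
  refine ⟨C, ?_⟩
  filter_upwards [hC, chart_source_mem_nhds H x] with y hy h'y v
  rw [← TangentBundle.continuousLinearMapAt_trivializationAt h'y]
  refine (ContinuousLinearMap.le_opENorm _ _).trans ?_
  gcongr
  rw [enorm_le_coe]
  exact_mod_cast hy.le

/-- Near any point `x`, the derivative of the inverse of the extended chart at `x` is bounded for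
the Riemannian norm. -/
lemma eventually_enorm_mfderivWithin_extChartAt_symm_apply_le [TopologicalSpace M]
    [ChartedSpace H M] [RiemannianBundle (fun x : M => TangentSpace I x)] [IsManifold I 1 M]
    [IsContinuousRiemannianBundle E (fun x : M => TangentSpace I x)] (x : M) :
    ∃ C : ℝ≥0, ∀ᶠ z in 𝓝[range I] (extChartAt I x x), ∀ w : E,
      ‖mfderivWithin 𝓘(ℝ, E) I (extChartAt I x).symm (range I) z w‖ₑ ≤ C * ‖w‖ₑ := by
  obtain ⟨C, C_pos, hC⟩ :=
    eventually_norm_symmL_trivializationAt_lt E (fun x : M => TangentSpace I x) x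
  lift C to ℝ≥0 using C_pos.le
  refine ⟨C, ?_⟩
  have hx : (extChartAt I x).symm (extChartAt I x x) = x := extChartAt_to_inv x
  have hc : ContinuousAt (extChartAt I x).symm (extChartAt I x x) := continuousAt_extChartAt_symm _
  have hC' := inter_mem hC (chart_source_mem_nhds H x)
  rw [← hx] at hC'
  filter_upwards [nhdsWithin_le_nhds (hc.preimage_mem_nhds (by simpa only [hx] using hC')),
    extChartAt_target_mem_nhdsWithin x] with z hz h'z w
  have key := TangentBundle.symmL_trivializationAt (I := I) hz.2
  rw [(extChartAt I x).right_inv h'z] at key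
  rw [← key]
  refine (ContinuousLinearMap.le_opENorm
    ((trivializationAt E (TangentSpace I) x).symmL ℝ ((extChartAt I x).symm z)) w).trans ?_
  gcongr
  rw [enorm_le_coe]
  exact_mod_cast hz.1.le

/-- Near any point, the Riemannian distance between two points is controlled by the distance of
their images in the extended chart. -/
lemma eventually_prod_riemannianEDist_le_edist_extChartAt [TopologicalSpace M] [ChartedSpace H M]
    [RiemannianBundle (fun x : M => TangentSpace I x)] [IsManifold I 1 M]
    [IsContinuousRiemannianBundle E (fun x : M => TangentSpace I x)] (x : M) :
    ∃ C : ℝ≥0, ∀ᶠ q : M × M in 𝓝 (x, x),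
      riemannianEDist I q.1 q.2 ≤ C * edist (extChartAt I x q.1) (extChartAt I x q.2) := by
  obtain ⟨C, hC⟩ := eventually_enorm_mfderivWithin_extChartAt_symm_apply_le (I := I) x
  refine ⟨C, ?_⟩
  obtain ⟨r, r_pos, hr⟩ := mem_nhdsWithin_iff.1 (inter_mem (extChartAt_target_mem_nhdsWithin x) hC)
  have A : (extChartAt I x) ⁻¹' (ball (extChartAt I x x) r ∩ range I) ∈ 𝓝 x := by
    apply extChartAt_preimage_mem_nhds_of_mem_nhdsWithin (by simp)
    rw [inter_comm]
    exact inter_mem_nhdsWithin _ (ball_mem_nhds _ r_pos)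
  have A' := inter_mem A (extChartAt_source_mem_nhds (I := I) x)
  filter_upwards [prod_mem_nhds A' A'] with ⟨y, z⟩ ⟨⟨hy, h'y⟩, ⟨hz, h'z⟩⟩
  dsimp only at hy h'y hz h'z ⊢
  -- The competitor for the distance is the straight segment in the chart, pulled back to the
  -- manifold. It stays where the derivative bound holds because a ball intersected with `range I`
  -- is convex.
  let η := ContinuousAffineMap.lineMap (R := ℝ) (extChartAt I x y) (extChartAt I x z)
  set γ := (extChartAt I x).symm ∘ η
  have hη := (image_subset_iff (s := Icc 0 1) (f := η)).1 <| by
    simp only [ContinuousAffineMap.coe_lineMap_eq, ← segment_eq_image_lineMap, η]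
    exact (((convex_ball _ _).inter I.convex_range).segment_subset hy hz).trans hr
  have hη₁ : Icc 0 1 ⊆ η ⁻¹' (extChartAt I x).target := fun t ht ↦ (hη ht).1
  have η_smooth : ContMDiffOn 𝓘(ℝ, ℝ) 𝓘(ℝ, E) 1 η (Icc 0 1) := by
    apply ContMDiff.contMDiffOn
    rw [contMDiff_iff_contDiff]
    exact ContinuousAffineMap.contDiff _
  have hle : riemannianEDist I y z ≤ pathELength I γ 0 1 := by
    apply riemannianEDist_le_pathELength _ _ _ zero_le_one
    · exact (contMDiffOn_extChartAt_symm x).comp η_smooth hη₁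
    · simp only [γ, η, Function.comp_apply, ContinuousAffineMap.coe_lineMap_eq,
        AffineMap.lineMap_apply_zero, (extChartAt I x).left_inv h'y]
    · simp only [γ, η, Function.comp_apply, ContinuousAffineMap.coe_lineMap_eq,
        AffineMap.lineMap_apply_one, (extChartAt I x).left_inv h'z]
  apply hle.trans
  rw [← lintegral_fderiv_lineMap_eq_edist, pathELength_eq_lintegral_mfderivWithin_Icc,
    ← lintegral_const_mul' _ _ ENNReal.coe_ne_top]
  refine setLIntegral_mono' measurableSet_Icc (fun t ht ↦ ?_)
  have hcomp : mfderivWithin 𝓘(ℝ, ℝ) I γ (Icc 0 1) t =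
      (mfderivWithin 𝓘(ℝ, E) I (extChartAt I x).symm (range I) (η t)) ∘L
        (mfderivWithin 𝓘(ℝ, ℝ) 𝓘(ℝ, E) η (Icc 0 1) t) := by
    apply mfderivWithin_comp
    · exact mdifferentiableWithinAt_extChartAt_symm (hη₁ ht)
    · exact η_smooth.mdifferentiableOn one_ne_zero t ht
    · exact hη₁.trans (preimage_mono (extChartAt_target_subset_range x))
    · rw [uniqueMDiffWithinAt_iff_uniqueDiffWithinAt]
      exact uniqueDiffOn_Icc zero_lt_one t ht
  rw [mfderivWithin_eq_fderivWithin] at hcomp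
  have hval := congrArg (fun L ↦ L (1 : ℝ)) hcomp
  exact (congrArg enorm hval).le.trans ((hη ht).2 _)

/-- If the derivative of the extended chart at `x` is bounded by `C` along a path, then the images
of the endpoints of the path in the chart are at distance at most `C` times its length. -/
lemma edist_extChartAt_le_mul_pathELength [TopologicalSpace M] [ChartedSpace H M]
    [RiemannianBundle (fun x : M => TangentSpace I x)] [IsManifold I 1 M] (x : M) {C : ℝ≥0}
    {γ : ℝ → M} (hγ : ContMDiffOn 𝓘(ℝ, ℝ) I 1 γ (Icc 0 1))
    (h : ∀ t ∈ Icc (0 : ℝ) 1, γ t ∈ (chartAt H x).source ∧ ∀ v : TangentSpace I (γ t),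
      enorm (E := E) (mfderiv I 𝓘(ℝ, E) (extChartAt I x) (γ t) v) ≤ C * ‖v‖ₑ) :
    edist (extChartAt I x (γ 0)) (extChartAt I x (γ 1)) ≤ C * pathELength I γ 0 1 := by
  set γ' := extChartAt I x ∘ γ
  have γ'_smooth : ContMDiffOn 𝓘(ℝ, ℝ) 𝓘(ℝ, E) 1 γ' (Icc 0 1) :=
    contMDiffOn_extChartAt.comp (I' := I) (t := (chartAt H x).source) hγ (fun t ht ↦ (h t ht).1)
  rw [edist_comm, edist_eq_enorm_sub]
  calc
      ‖γ' 1 - γ' 0‖ₑ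
    _ ≤ ∫⁻ t in Icc 0 1, ‖derivWithin γ' (Icc 0 1) t‖ₑ := by
      apply enorm_sub_le_lintegral_derivWithin_Icc_of_contDiffOn_Icc _ zero_le_one
      rwa [← contMDiffOn_iff_contDiffOn]
    _ ≤ ∫⁻ t in Icc 0 1, C * ‖mfderivWithin 𝓘(ℝ, ℝ) I γ (Icc 0 1) t 1‖ₑ := by
      refine setLIntegral_mono' measurableSet_Icc (fun t ht ↦ ?_)
      have hcomp : mfderivWithin 𝓘(ℝ, ℝ) 𝓘(ℝ, E) γ' (Icc 0 1) t =
          (mfderiv I 𝓘(ℝ, E) (extChartAt I x) (γ t)) ∘L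
            (mfderivWithin 𝓘(ℝ, ℝ) I γ (Icc 0 1) t) := by
        apply mfderiv_comp_mfderivWithin
        · exact mdifferentiableAt_extChartAt (h t ht).1
        · exact (hγ.mdifferentiableOn one_ne_zero) _ ht
        · rw [uniqueMDiffWithinAt_iff_uniqueDiffWithinAt]
          exact uniqueDiffOn_Icc zero_lt_one _ ht
      rw [mfderivWithin_eq_fderivWithin] at hcomp
      have hval := congrArg (fun L ↦ L (1 : ℝ)) hcomp
      rw [← fderivWithin_derivWithin]
      exact (congrArg (enorm (E := E)) hval).le.trans ((h t ht).2 _)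
    _ = C * pathELength I γ 0 1 := by
      rw [lintegral_const_mul' _ _ ENNReal.coe_ne_top,
          pathELength_eq_lintegral_mfderivWithin_Icc]

/-- Near any point of a Riemannian manifold, the distance of the images of two points in the
extended chart is controlled by their Riemannian distance. -/
lemma eventually_prod_edist_extChartAt_le_edist [PseudoEMetricSpace M] [ChartedSpace H M]
    [RiemannianBundle (fun x : M => TangentSpace I x)] [IsManifold I 1 M]
    [IsContinuousRiemannianBundle E (fun x : M => TangentSpace I x)]
    [IsRiemannianManifold I M] (x : M) :
    ∃ C : ℝ≥0, ∀ᶠ q : M × M in 𝓝 (x, x),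
      edist (extChartAt I x q.1) (extChartAt I x q.2) ≤ C * edist q.1 q.2 := by
  obtain ⟨C, hC⟩ := eventually_enorm_mfderiv_extChartAt_apply_le (I := I) x
  refine ⟨C, ?_⟩
  obtain ⟨r, r_pos, hr⟩ := EMetric.mem_nhds_iff.1 (inter_mem (chart_source_mem_nhds H x) hC)
  -- A path of length less than 2r/3 starting within r/3 of `x` stays in the ball of radius r, where
  -- the derivative bound holds.
  have r3 : 0 < r / 3 := ENNReal.div_pos r_pos.ne' (by simp)
  have B := Metric.eball_mem_nhds x r3
  filter_upwards [prod_mem_nhds B B] with ⟨y, z⟩ ⟨hy, hz⟩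
  dsimp only at hy hz ⊢
  rw [Metric.mem_eball] at hy hz
  have hyz : edist y z < r / 3 + r / 3 := by
    calc edist y z ≤ edist y x + edist x z := edist_triangle _ _ _
      _ < r / 3 + r / 3 := by rw [edist_comm x z]; exact ENNReal.add_lt_add hy hz
  -- The infimum of lengths need not be attained, so the bound is proved for every slightly larger
  -- `s` and then `s` decreases to the distance.
  have key : ∀ s, edist y z < s → s ≤ r / 3 + r / 3 →
      edist (extChartAt I x y) (extChartAt I x z) ≤ C * s := by
    intro s hs hsr
    rw [IsRiemannianManifold.out (I := I) y z] at hs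
    obtain ⟨γ, rfl, rfl, hγ, hlen⟩ := exists_lt_of_riemannianEDist_lt hs
    refine (edist_extChartAt_le_mul_pathELength x hγ fun t ht ↦ hr ?_).trans (by gcongr)
    have h0 : edist (γ 0) (γ t) < r / 3 + r / 3 := by
      rw [IsRiemannianManifold.out (I := I)]
      calc riemannianEDist I (γ 0) (γ t) ≤ pathELength I γ 0 t :=
            riemannianEDist_le_pathELength (hγ.mono (Icc_subset_Icc_right ht.2)) rfl rfl ht.1
        _ ≤ pathELength I γ 0 1 := pathELength_mono le_rfl ht.2
        _ < r / 3 + r / 3 := hlen.trans_le hsr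
    calc edist (γ t) x ≤ edist (γ 0) (γ t) + edist (γ 0) x := by
          rw [edist_comm (γ 0) (γ t)]; exact edist_triangle _ _ _
      _ < r / 3 + r / 3 + r / 3 := ENNReal.add_lt_add h0 hy
      _ = r := ENNReal.add_thirds r
  have hlim : Tendsto (fun s ↦ (C : ℝ≥0∞) * s) (𝓝[>] edist y z) (𝓝 (C * edist y z)) :=
    ((ENNReal.continuous_const_mul ENNReal.coe_ne_top).tendsto _).mono_left nhdsWithin_le_nhds
  have : (𝓝[>] edist y z).NeBot := nhdsGT_neBot_of_exists_gt ⟨_, hyz⟩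
  refine ge_of_tendsto hlim ?_
  filter_upwards [Ioo_mem_nhdsGT hyz] with s hs using key s hs.1 hs.2.le

end ChartDistance

/-! ### Local Lipschitz bounds in charts and trivializations. -/

section LocalLipschitz

open Filter
open scoped NNReal

/-- Two extended nonnegative functions which are continuous at a point, with finite nonzero values
there, bound each other up to a constant near this point. -/
lemma exists_eventually_le_mul_of_continuousAt {X : Type*} [TopologicalSpace X] {g h : X → ℝ≥0∞}
    {a : X} (hg : ContinuousAt g a) (hh : ContinuousAt h a) (hg' : g a ≠ ⊤) (hh' : h a ≠ 0) :
    ∃ C : ℝ≥0, ∀ᶠ x in 𝓝 a, g x ≤ C * h x := by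
  -- Near `a`, `h` stays above `c` > 0 and `g` below a finite `b`, so b/c works.
  obtain ⟨c, hc0, hc⟩ := ENNReal.lt_iff_exists_nnreal_btwn.1 (pos_iff_ne_zero.2 hh')
  obtain ⟨b, hb, -⟩ := ENNReal.lt_iff_exists_nnreal_btwn.1 (lt_top_iff_ne_top.2 hg')
  have hc0' : (c : ℝ≥0∞) ≠ 0 := hc0.ne'
  refine ⟨b / c, ?_⟩
  filter_upwards [hg.eventually_lt_const hb, hh.eventually_const_lt hc] with x hx hx'
  calc g x ≤ b := hx.le
    _ = (b / c : ℝ≥0) * c := by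
      rw [← ENNReal.coe_mul, div_mul_cancel₀ _ (by exact_mod_cast hc0')]
    _ ≤ _ := by gcongr

variable {E : Type*} [NormedAddCommGroup E] [NormedSpace ℝ E]
  {H : Type*} [TopologicalSpace H] {I : ModelWithCorners ℝ E H}
  {M : Type*} [TopologicalSpace M] [ChartedSpace H M]
  {E' : Type*} [NormedAddCommGroup E'] [NormedSpace ℝ E']
  {H' : Type*} [TopologicalSpace H'] {I' : ModelWithCorners ℝ E' H'}
  {N : Type*} [TopologicalSpace N] [ChartedSpace H' N]

/-- A map of class `C^1` at a point is Lipschitz near this point, when read in charts. -/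
lemma ContMDiffAt.eventually_edist_extChartAt_le [I.Boundaryless] {f : M → N} {x : M}
    (hf : ContMDiffAt I I' 1 f x) :
    ∃ C : ℝ≥0, ∀ᶠ q : M × M in 𝓝 (x, x),
      edist (extChartAt I' (f x) (f q.1)) (extChartAt I' (f x) (f q.2)) ≤
        C * edist (extChartAt I x q.1) (extChartAt I x q.2) := by
  have h := (contMDiffAt_iff.1 hf).2
  rw [I.range_eq_univ, contDiffWithinAt_univ] at h
  obtain ⟨C, t, ht, hC⟩ := h.exists_lipschitzOnWith
  refine ⟨C, ?_⟩
  have A : (extChartAt I x) ⁻¹' t ∩ (extChartAt I x).source ∈ 𝓝 x :=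
    inter_mem ((continuousAt_extChartAt x).preimage_mem_nhds ht) (extChartAt_source_mem_nhds x)
  filter_upwards [prod_mem_nhds A A] with ⟨y, z⟩ ⟨hy, hz⟩
  have := hC hy.1 hz.1
  simpa only [Function.comp_apply, (extChartAt I x).left_inv hy.2,
    (extChartAt I x).left_inv hz.2] using this

variable [IsManifold I 1 M]

/-- The base coordinates of the two vectors coincide, so only the fibre coordinate contributes to
the sup distance of the product. -/
lemma edist_extChartAt_tangentBundle (p : TangentBundle I M) (x : M) (u v : TangentSpace I x) :
    edist (extChartAt I.tangent p ⟨x, u⟩) (extChartAt I.tangent p ⟨x, v⟩) =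
      edist (trivializationAt E (TangentSpace I) p.proj ⟨x, u⟩).2
        (trivializationAt E (TangentSpace I) p.proj ⟨x, v⟩).2 := by
  rw [FiberBundle.extChartAt]
  change edist ((_, _) : E × E) (_, _) = _
  rw [Prod.edist_eq]
  simp

lemma edist_trivializationAt_tangentBundle_eq {x y : M}
    (hy : y ∈ (trivializationAt E (TangentSpace I) x).baseSet) (u v : TangentSpace I y) :
    edist (trivializationAt E (TangentSpace I) x ⟨y, u⟩).2
        (trivializationAt E (TangentSpace I) x ⟨y, v⟩).2 =
      ‖(trivializationAt E (TangentSpace I) x).continuousLinearMapAt ℝ y (u - v)‖ₑ := by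
  rw [map_sub, edist_eq_enorm_sub]
  simp only [Trivialization.continuousLinearMapAt_apply, Trivialization.linearMapAt_apply, hy,
    if_true]

variable [RiemannianBundle (fun x : M => TangentSpace I x)]
  [IsContinuousRiemannianBundle E (fun x : M => TangentSpace I x)]

/-- Near a point, the distance of two tangent vectors with the same base point, read in the
trivialization of the tangent bundle, is controlled by the Riemannian norm of their difference. -/
lemma eventually_edist_trivializationAt_le_enorm_sub (x : M) :
    ∃ C : ℝ≥0, ∀ᶠ y in 𝓝 x, ∀ u v : TangentSpace I y,
      edist (trivializationAt E (TangentSpace I) x ⟨y, u⟩).2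
        (trivializationAt E (TangentSpace I) x ⟨y, v⟩).2 ≤ C * ‖u - v‖ₑ := by
  obtain ⟨C, C_pos, hC⟩ := eventually_norm_trivializationAt_lt E (fun x : M => TangentSpace I x) x
  lift C to ℝ≥0 using C_pos.le
  refine ⟨C, ?_⟩
  filter_upwards [hC, (trivializationAt E (TangentSpace I) x).open_baseSet.mem_nhds
    (FiberBundle.mem_baseSet_trivializationAt' x)] with y hy hy' u v
  rw [edist_trivializationAt_tangentBundle_eq hy']
  refine (ContinuousLinearMap.le_opENorm _ _).trans ?_
  gcongr
  rw [enorm_le_coe]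
  exact_mod_cast hy.le

/-- Near a point, the Riemannian norm of the difference of two tangent vectors with the same base
point is controlled by their distance in the trivialization of the tangent bundle. -/
lemma eventually_enorm_sub_le_edist_trivializationAt (x : M) :
    ∃ C : ℝ≥0, ∀ᶠ y in 𝓝 x, ∀ u v : TangentSpace I y,
      ‖u - v‖ₑ ≤ C * edist (trivializationAt E (TangentSpace I) x ⟨y, u⟩).2
        (trivializationAt E (TangentSpace I) x ⟨y, v⟩).2 := by
  obtain ⟨C, C_pos, hC⟩ :=
    eventually_norm_symmL_trivializationAt_lt E (fun x : M => TangentSpace I x) x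
  lift C to ℝ≥0 using C_pos.le
  refine ⟨C, ?_⟩
  filter_upwards [hC, (trivializationAt E (TangentSpace I) x).open_baseSet.mem_nhds
    (FiberBundle.mem_baseSet_trivializationAt' x)] with y hy hy' u v
  rw [edist_trivializationAt_tangentBundle_eq hy']
  nth_rewrite 1 [← (trivializationAt E (TangentSpace I) x).symmL_continuousLinearMapAt (R := ℝ) hy'
    (u - v)]
  refine (ContinuousLinearMap.le_opENorm _ _).trans ?_
  gcongr
  rw [enorm_le_coe]
  exact_mod_cast hy.le

end LocalLipschitz

/-! ### Fibrewise bilipschitz bounds, locally and on compact sets. -/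

section FiberwiseBilipschitz

open Filter
open scoped NNReal

lemma ContinuousAt.edist_fst_snd {X Y : Type*} [TopologicalSpace X] [PseudoEMetricSpace Y]
    {k : X → Y} {p q : X} (hp : ContinuousAt k p) (hq : ContinuousAt k q) :
    ContinuousAt (fun a : X × X ↦ edist (k a.1) (k a.2)) (p, q) := by
  have h : ContinuousAt (fun a : X × X ↦ (k a.1, k a.2)) (p, q) :=
    ContinuousAt.prodMk
      (ContinuousAt.comp (x := (p, q)) (f := Prod.fst) hp continuousAt_fst)
      (ContinuousAt.comp (x := (p, q)) (f := Prod.snd) hq continuousAt_snd)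
  exact ContinuousAt.comp (x := (p, q)) continuous_edist.continuousAt h

variable {E : Type*} [NormedAddCommGroup E] [NormedSpace ℝ E]
  {H : Type*} [TopologicalSpace H] {I : ModelWithCorners ℝ E H} [I.Boundaryless]
  {M : Type*} [MetricSpace M] [ChartedSpace H M] [IsManifold I 1 M]
  [RiemannianBundle (fun x : M => TangentSpace I x)]
  [IsContinuousRiemannianBundle E (fun x : M => TangentSpace I x)] [IsRiemannianManifold I M]

/-- A map from the tangent bundle to the manifold which is `C^1` at a point is fiberwise Lipschitz
near this point. -/
lemma ContMDiffAt.eventually_edist_le_enorm_sub {f : TangentBundle I M → M} {p : TangentBundle I M}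
    (hf : ContMDiffAt I.tangent I 1 f p) :
    ∃ C : ℝ≥0, ∀ᶠ a : TangentBundle I M × TangentBundle I M in 𝓝 (p, p),
      ∀ (x : M) (u v : TangentSpace I x), a = (⟨x, u⟩, ⟨x, v⟩) →
        edist (f ⟨x, u⟩) (f ⟨x, v⟩) ≤ C * ‖u - v‖ₑ := by
  obtain ⟨C₁, h₁⟩ := eventually_prod_riemannianEDist_le_edist_extChartAt (I := I) (f p)
  obtain ⟨C₂, h₂⟩ := hf.eventually_edist_extChartAt_le
  obtain ⟨C₃, h₃⟩ := eventually_edist_trivializationAt_le_enorm_sub (I := I) p.proj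
  have hc : ContinuousAt (fun a : TangentBundle I M × TangentBundle I M ↦ (f a.1, f a.2)) (p, p) :=
    ContinuousAt.prodMk
      (ContinuousAt.comp (x := (p, p)) (f := Prod.fst) hf.continuousAt continuousAt_fst)
      (ContinuousAt.comp (x := (p, p)) (f := Prod.snd) hf.continuousAt continuousAt_snd)
  have hπ : ContinuousAt (fun a : TangentBundle I M × TangentBundle I M ↦ a.1.proj) (p, p) :=
    ((FiberBundle.continuous_proj E (TangentSpace I)).comp continuous_fst).continuousAt
  refine ⟨C₁ * (C₂ * C₃), ?_⟩
  filter_upwards [hc.eventually h₁, h₂, hπ.eventually h₃] with a h₁ h₂ h₃ x u v rfl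
  rw [edist_extChartAt_tangentBundle] at h₂
  rw [IsRiemannianManifold.out (I := I)]
  push_cast
  calc _ ≤ _ := h₁
    _ ≤ C₁ * (C₂ * (C₃ * ‖u - v‖ₑ)) := by
      refine mul_le_mul_right (h₂.trans (mul_le_mul_right (h₃ u v) _)) _
    _ = _ := by ring

/-- If `(x, v) ↦ (x, f (x, v))` has a `C^1` local left inverse, then `f` is fiberwise expanding up
to a constant. -/
lemma ContMDiffAt.eventually_enorm_sub_le_edist {f : TangentBundle I M → M} {p : TangentBundle I M}
    {g : M × M → TangentBundle I M} (hf : ContinuousAt f p)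
    (hg : ContMDiffAt (I.prod I) I.tangent 1 g (p.proj, f p))
    (hgf : ∀ᶠ a in 𝓝 p, g (a.proj, f a) = a) :
    ∃ C : ℝ≥0, ∀ᶠ a : TangentBundle I M × TangentBundle I M in 𝓝 (p, p),
      ∀ (x : M) (u v : TangentSpace I x), a = (⟨x, u⟩, ⟨x, v⟩) →
        ‖u - v‖ₑ ≤ C * edist (f ⟨x, u⟩) (f ⟨x, v⟩) := by
  obtain ⟨C₁, h₁⟩ := eventually_prod_edist_extChartAt_le_edist (I := I) (f p)
  obtain ⟨C₂, h₂⟩ := hg.eventually_edist_extChartAt_le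
  obtain ⟨C₃, h₃⟩ := eventually_enorm_sub_le_edist_trivializationAt (I := I) p.proj
  have hfst : ContinuousAt (fun a : TangentBundle I M × TangentBundle I M ↦ f a.1) (p, p) :=
    ContinuousAt.comp (x := (p, p)) (f := Prod.fst) hf continuousAt_fst
  have hsnd : ContinuousAt (fun a : TangentBundle I M × TangentBundle I M ↦ f a.2) (p, p) :=
    ContinuousAt.comp (x := (p, p)) (f := Prod.snd) hf continuousAt_snd
  have hπ := FiberBundle.continuous_proj E (TangentSpace I : M → Type _)
  have hc : ContinuousAt (fun a : TangentBundle I M × TangentBundle I M ↦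
      ((a.1.proj, f a.1), (a.2.proj, f a.2))) (p, p) :=
    ((hπ.comp continuous_fst).continuousAt.prodMk hfst).prodMk
      ((hπ.comp continuous_snd).continuousAt.prodMk hsnd)
  refine ⟨C₃ * (C₂ * C₁), ?_⟩
  -- The chart in the target of `g` is thereby the one at `p`.
  rw [hgf.self_of_nhds] at h₂
  filter_upwards [(hfst.prodMk hsnd).eventually h₁, hc.eventually h₂,
    (hπ.comp continuous_fst).continuousAt.eventually h₃,
    continuousAt_fst.eventually hgf, continuousAt_snd.eventually hgf]
    with a h₁ h₂ h₃ ha ha' x u v rfl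
  simp only at ha ha' h₁ h₂
  rw [ha, ha', edist_extChartAt_tangentBundle, extChartAt_prod] at h₂
  -- Both points of `M × M` have first component `x`, so their chart distance reduces to that of the
  -- values of `f`.
  simp only [PartialEquiv.prod_coe, Prod.edist_eq, edist_self, zero_le, sup_of_le_right] at h₂
  push_cast
  calc ‖u - v‖ₑ ≤ _ := h₃ u v
    _ ≤ C₃ * (C₂ * (C₁ * edist (f ⟨x, u⟩) (f ⟨x, v⟩))) := by
      refine mul_le_mul_right (h₂.trans (mul_le_mul_right h₁ _)) _
    _ = _ := by ring

omit [I.Boundaryless] [IsRiemannianManifold I M] in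
/-- Two distinct tangent vectors with the same base point and distinct images under a map `f`:
near them, `f` is fiberwise bilipschitz. -/
lemma eventually_edist_le_enorm_sub_of_ne {f : TangentBundle I M → M} {p q : TangentBundle I M}
    (hpq : p ≠ q) (hπ : p.proj = q.proj) (hp : ContinuousAt f p) (hq : ContinuousAt f q)
    (hf : f p ≠ f q) :
    ∃ C : ℝ≥0, ∀ᶠ a : TangentBundle I M × TangentBundle I M in 𝓝 (p, q),
      ∀ (x : M) (u v : TangentSpace I x), a = (⟨x, u⟩, ⟨x, v⟩) →
        edist (f ⟨x, u⟩) (f ⟨x, v⟩) ≤ C * ‖u - v‖ₑ ∧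
          ‖u - v‖ₑ ≤ C * edist (f ⟨x, u⟩) (f ⟨x, v⟩) := by
  -- As `p` and `q` share a base point, this one trivialization serves both; in it their fibre
  -- coordinates differ.
  set e := trivializationAt E (TangentSpace I : M → Type _) p.proj with he
  have hpe : p ∈ e.source := FiberBundle.mem_trivializationAt_proj_source
  have hqe : q ∈ e.source := by
    rw [he, hπ]; exact FiberBundle.mem_trivializationAt_proj_source
  have hne : (e p).2 ≠ (e q).2 := by
    intro h
    refine hpq (e.injOn hpe hqe (Prod.ext ?_ h))
    exact ((e.coe_fst hpe).trans hπ).trans (e.coe_fst hqe).symm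
  have h₁ : ContinuousAt (fun a : TangentBundle I M × TangentBundle I M ↦
      edist (f a.1) (f a.2)) (p, q) :=
    hp.edist_fst_snd hq
  have h₂ : ContinuousAt (fun a : TangentBundle I M × TangentBundle I M ↦
      edist (e a.1).2 (e a.2).2) (p, q) :=
    ContinuousAt.edist_fst_snd (e.continuousAt hpe).snd (e.continuousAt hqe).snd
  obtain ⟨C₁, hC₁⟩ := exists_eventually_le_mul_of_continuousAt h₁ h₂ (edist_ne_top _ _)
    (edist_pos.2 hne).ne'
  obtain ⟨C₂, hC₂⟩ := exists_eventually_le_mul_of_continuousAt h₂ h₁ (edist_ne_top _ _)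
    (edist_pos.2 hf).ne'
  obtain ⟨C₃, h₃⟩ := eventually_edist_trivializationAt_le_enorm_sub (I := I) p.proj
  obtain ⟨C₄, h₄⟩ := eventually_enorm_sub_le_edist_trivializationAt (I := I) p.proj
  have hπ' : ContinuousAt (fun a : TangentBundle I M × TangentBundle I M ↦ a.1.proj) (p, q) :=
    ((FiberBundle.continuous_proj E (TangentSpace I)).comp continuous_fst).continuousAt
  refine ⟨max (C₁ * C₃) (C₄ * C₂), ?_⟩
  filter_upwards [hC₁, hC₂, hπ'.eventually h₃, hπ'.eventually h₄] with a h₁ h₂ h₃ h₄ x u v rfl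
  constructor
  · calc edist (f ⟨x, u⟩) (f ⟨x, v⟩) ≤ C₁ * (C₃ * ‖u - v‖ₑ) :=
          h₁.trans (mul_le_mul_right (h₃ u v) _)
      _ = (C₁ * C₃ : ℝ≥0) * ‖u - v‖ₑ := by push_cast; ring
      _ ≤ _ := by gcongr; exact le_max_left _ _
  · calc ‖u - v‖ₑ ≤ C₄ * (C₂ * edist (f ⟨x, u⟩) (f ⟨x, v⟩)) :=
          (h₄ u v).trans (mul_le_mul_right h₂ _)
      _ = (C₄ * C₂ : ℝ≥0) * edist (f ⟨x, u⟩) (f ⟨x, v⟩) := by push_cast; ring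
      _ ≤ _ := by gcongr; exact le_max_right _ _

/-- Let `f` be a map from the tangent bundle to the manifold such that `(x, v) ↦ (x, f (x, v))` is
a `C^1` partial diffeomorphism. Then `f` is fiberwise bilipschitz on compact subsets of its
domain, with uniform constants. -/
theorem PartialDiffeomorph.exists_fiberwise_bilipschitz {f : TangentBundle I M → M}
    (Φ : PartialDiffeomorph I.tangent (I.prod I) (TangentBundle I M) (M × M) 1)
    (hΦ : ∀ a ∈ Φ.source, Φ a = (a.proj, f a)) {S : Set (TangentBundle I M)} (hS : IsCompact S)
    (hSΦ : S ⊆ Φ.source) :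
    ∃ C : ℝ≥0, ∀ (x : M) (u v : TangentSpace I x),
      (⟨x, u⟩ : TangentBundle I M) ∈ S → (⟨x, v⟩ : TangentBundle I M) ∈ S →
        edist (f ⟨x, u⟩) (f ⟨x, v⟩) ≤ C * ‖u - v‖ₑ ∧
          ‖u - v‖ₑ ≤ C * edist (f ⟨x, u⟩) (f ⟨x, v⟩) := by
  have hf : ∀ p ∈ Φ.source, ContMDiffAt I.tangent I 1 f p := by
    intro p hp
    have hΦp := Φ.open_source.mem_nhds hp
    refine ((Φ.contMDiffOn_toFun.contMDiffAt hΦp).snd).congr_of_eventuallyEq ?_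
    filter_upwards [hΦp] with a ha
    exact (congrArg Prod.snd (hΦ a ha)).symm
  suffices h : ∃ C : ℝ≥0, ∀ (x : M) (u v : TangentSpace I x),
      ((⟨x, u⟩, ⟨x, v⟩) : TangentBundle I M × TangentBundle I M) ∈ S ×ˢ S →
        edist (f ⟨x, u⟩) (f ⟨x, v⟩) ≤ C * ‖u - v‖ₑ ∧
          ‖u - v‖ₑ ≤ C * edist (f ⟨x, u⟩) (f ⟨x, v⟩) by
    obtain ⟨C, hC⟩ := h
    exact ⟨C, fun x u v hu hv ↦ hC x u v ⟨hu, hv⟩⟩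
  -- The property passes to subsets and finite unions (with the larger constant), so only
  -- neighbourhoods of single pairs need treatment.
  refine (hS.prod hS).induction_on (p := fun s ↦ ∃ C : ℝ≥0, ∀ (x : M) (u v : TangentSpace I x),
      ((⟨x, u⟩, ⟨x, v⟩) : TangentBundle I M × TangentBundle I M) ∈ s →
        edist (f ⟨x, u⟩) (f ⟨x, v⟩) ≤ C * ‖u - v‖ₑ ∧
          ‖u - v‖ₑ ≤ C * edist (f ⟨x, u⟩) (f ⟨x, v⟩)) ?_ ?_ ?_ ?_
  · exact ⟨0, fun x u v h ↦ h.elim⟩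
  · rintro s t hst ⟨C, hC⟩
    exact ⟨C, fun x u v h ↦ hC x u v (hst h)⟩
  · rintro s t ⟨C, hC⟩ ⟨C', hC'⟩
    refine ⟨max C C', fun x u v h ↦ ?_⟩
    rcases h with h | h
    · obtain ⟨h₁, h₂⟩ := hC x u v h
      exact ⟨h₁.trans (by gcongr; exact le_max_left _ _),
        h₂.trans (by gcongr; exact le_max_left _ _)⟩
    · obtain ⟨h₁, h₂⟩ := hC' x u v h
      exact ⟨h₁.trans (by gcongr; exact le_max_right _ _),
        h₂.trans (by gcongr; exact le_max_right _ _)⟩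
  · rintro ⟨p, q⟩ ⟨hp, hq⟩
    suffices h : ∃ C : ℝ≥0, ∀ᶠ a : TangentBundle I M × TangentBundle I M in 𝓝 (p, q),
        ∀ (x : M) (u v : TangentSpace I x), a = (⟨x, u⟩, ⟨x, v⟩) →
          edist (f ⟨x, u⟩) (f ⟨x, v⟩) ≤ C * ‖u - v‖ₑ ∧
            ‖u - v‖ₑ ≤ C * edist (f ⟨x, u⟩) (f ⟨x, v⟩) by
      obtain ⟨C, hC⟩ := h
      exact ⟨_, mem_nhdsWithin_of_mem_nhds hC, C, fun x u v h ↦ h x u v rfl⟩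
    have hp' : p ∈ Φ.source := hSΦ hp
    have hq' : q ∈ Φ.source := hSΦ hq
    by_cases hpq : p = q
    · subst hpq
      obtain ⟨C₁, h₁⟩ := (hf p hp').eventually_edist_le_enorm_sub
      have hg : ContMDiffAt (I.prod I) I.tangent 1 Φ.invFun (p.proj, f p) := by
        refine Φ.contMDiffOn_invFun.contMDiffAt (Φ.open_target.mem_nhds ?_)
        rw [← hΦ p hp']
        exact Φ.map_source hp'
      have hgf : ∀ᶠ a in 𝓝 p, Φ.invFun (a.proj, f a) = a := by
        filter_upwards [Φ.open_source.mem_nhds hp'] with a ha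
        rw [← hΦ a ha]
        exact Φ.left_inv ha
      obtain ⟨C₂, h₂⟩ := hg.eventually_enorm_sub_le_edist (hf p hp').continuousAt hgf
      refine ⟨max C₁ C₂, ?_⟩
      filter_upwards [h₁, h₂] with a h₁ h₂ x u v ha
      exact ⟨(h₁ x u v ha).trans (by gcongr; exact le_max_left _ _),
        (h₂ x u v ha).trans (by gcongr; exact le_max_right _ _)⟩
    by_cases hπ : p.proj = q.proj
    · refine eventually_edist_le_enorm_sub_of_ne hpq hπ (hf p hp').continuousAt
        (hf q hq').continuousAt fun h ↦ hpq (Φ.injOn hp' hq' ?_)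
      exact (hΦ p hp').trans ((Prod.ext hπ h).trans (hΦ q hq').symm)
    -- Any constant works: different base points persist nearby, so the claim is vacuous.
    · refine ⟨0, ?_⟩
      have hπc := FiberBundle.continuous_proj E (TangentSpace I : M → Type _)
      have : ∀ᶠ a : TangentBundle I M × TangentBundle I M in 𝓝 (p, q), a.1.proj ≠ a.2.proj :=
        (isOpen_ne_fun (hπc.comp continuous_fst) (hπc.comp continuous_snd)).mem_nhds hπ
      filter_upwards [this] with a ha x u v rfl
      exact (ha rfl).elim

end FiberwiseBilipschitz

/-! ### Compactness of closed tubes in the tangent bundle. -/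

section CompactTube

open Filter
open scoped NNReal

variable {E : Type*} [NormedAddCommGroup E] [NormedSpace ℝ E]
  {H : Type*} [TopologicalSpace H] {I : ModelWithCorners ℝ E H}
  {M : Type*} [TopologicalSpace M] [ChartedSpace H M] [IsManifold I 1 M]
  [RiemannianBundle (fun x : M => TangentSpace I x)]
  [IsContinuousRiemannianBundle E (fun x : M => TangentSpace I x)]

lemma continuous_enorm_tangentBundle :
    Continuous (fun p : TangentBundle I M ↦ ‖(p.2 : TangentSpace I p.proj)‖ₑ) := by
  have h : Continuous (fun p : TangentBundle I M ↦
      inner ℝ (p.2 : TangentSpace I p.proj) (p.2 : TangentSpace I p.proj)) :=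
    Continuous.inner_bundle (F := E) (E := fun x : M => TangentSpace I x)
      (b := fun p : TangentBundle I M ↦ p.proj) (v := fun p ↦ p.2) (w := fun p ↦ p.2)
      continuous_id continuous_id
  have h' : Continuous (fun p : TangentBundle I M ↦ ‖(p.2 : TangentSpace I p.proj)‖) := by
    simp_rw [norm_eq_sqrt_real_inner]
    exact h.sqrt
  simp_rw [← ofReal_norm]
  exact ENNReal.continuous_ofReal.comp h'

variable [FiniteDimensional ℝ E]

/-- Tangent vectors of bounded norm over a compact set are contained in a compact set. -/
lemma IsCompact.exists_isCompact_tangentBundle {K : Set M} (hK : IsCompact K) (r : ℝ≥0) :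
    ∃ Z : Set (TangentBundle I M), IsCompact Z ∧
      ∀ p : TangentBundle I M, p.proj ∈ K → ‖(p.2 : TangentSpace I p.proj)‖ₑ ≤ r → p ∈ Z := by
  have : LocallyCompactSpace M := Manifold.locallyCompact_of_finiteDimensional I
  have : ProperSpace E := FiniteDimensional.proper ℝ E
  refine hK.induction_on (p := fun K ↦ ∃ Z : Set (TangentBundle I M), IsCompact Z ∧
      ∀ p : TangentBundle I M, p.proj ∈ K → ‖(p.2 : TangentSpace I p.proj)‖ₑ ≤ r → p ∈ Z)
    ⟨∅, isCompact_empty, fun p h _ ↦ h.elim⟩ ?_ ?_ ?_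
  · rintro s t hst ⟨Z, hZ, h⟩
    exact ⟨Z, hZ, fun p hp ↦ h p (hst hp)⟩
  · rintro s t ⟨Z, hZ, h⟩ ⟨Z', hZ', h'⟩
    exact ⟨Z ∪ Z', hZ.union hZ', fun p hp hr ↦ hp.imp (fun hp ↦ h p hp hr) fun hp ↦ h' p hp hr⟩
  · intro x _
    obtain ⟨C, C_pos, hC⟩ :=
      eventually_norm_trivializationAt_lt E (fun x : M => TangentSpace I x) x
    set e := trivializationAt E (TangentSpace I : M → Type _) x
    -- Over a compact neighbourhood `W` where the trivialization has norm below `C`, vectors of norm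
    -- at most `r` land in `W` times the closed ball of radius `C * r`, which is compact.
    obtain ⟨W, hWx, hW, hWc⟩ := local_compact_nhds
      (inter_mem hC (e.open_baseSet.mem_nhds (FiberBundle.mem_baseSet_trivializationAt' x)))
    refine ⟨W, mem_nhdsWithin_of_mem_nhds hWx,
      e.toOpenPartialHomeomorph.symm '' (W ×ˢ Metric.closedBall (0 : E) (C * r)),
      (hWc.prod (isCompact_closedBall _ _)).image_of_continuousOn
        (e.toOpenPartialHomeomorph.continuousOn_symm.mono ?_), ?_⟩
    · rintro ⟨y, w⟩ ⟨hy, -⟩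
      exact e.mem_target.2 (hW hy).2
    · intro p hp hr
      have hpe : p ∈ e.source := e.mem_source.2 (hW hp).2
      refine ⟨e p, ⟨?_, ?_⟩, e.toOpenPartialHomeomorph.left_inv hpe⟩
      · rw [e.coe_fst hpe]
        exact hp
      · have h : (e p).2 = e.continuousLinearMapAt ℝ p.proj p.2 := by
          rw [Trivialization.continuousLinearMapAt_apply, Trivialization.linearMapAt_apply,
            if_pos (hW hp).2]
        rw [h, mem_closedBall_zero_iff]
        refine (ContinuousLinearMap.le_opNorm _ _).trans ?_
        gcongr
        · exact (hW hp).1.le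
        · exact enorm_le_coe.1 hr

/-- The closed tube of continuous finite radius over a compact set is compact. -/
lemma IsCompact.tangentBundle_tube [T2Space M] {K : Set M} (hK : IsCompact K) {ρ : M → ℝ≥0∞}
    (hρ : Continuous ρ) (hρK : ∀ x ∈ K, ρ x ≠ ⊤) :
    IsCompact {p : TangentBundle I M | p.proj ∈ K ∧
      ‖(p.2 : TangentSpace I p.proj)‖ₑ ≤ ρ p.proj} := by
  have hπ := FiberBundle.continuous_proj E (TangentSpace I : M → Type _)
  obtain ⟨r, hr⟩ : ∃ r : ℝ≥0, ∀ x ∈ K, ρ x ≤ r := by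
    rcases K.eq_empty_or_nonempty with rfl | hne
    · exact ⟨0, fun x h ↦ h.elim⟩
    · obtain ⟨x, hx, hmax⟩ := hK.exists_isMaxOn hne hρ.continuousOn
      refine ⟨(ρ x).toNNReal, fun y hy ↦ ?_⟩
      rw [ENNReal.coe_toNNReal (hρK x hx)]
      exact hmax hy
  obtain ⟨Z, hZ, h⟩ := hK.exists_isCompact_tangentBundle (I := I) r
  refine hZ.of_isClosed_subset ?_ fun p hp ↦ h p hp.1 (hp.2.trans (hr _ hp.1))
  exact (hK.isClosed.preimage hπ).inter
    (isClosed_le continuous_enorm_tangentBundle (hρ.comp hπ))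

end CompactTube

/-! ### Application to retractions. -/

section Retraction

open scoped NNReal

variable {D : ℕ} {M : Type*} [MetricSpace M] [ChartedSpace (EuclideanSpace ℝ (Fin D)) M]
  [IsManifold (𝓡 D) ∞ M] [RiemannianBundle (fun x : M => TangentSpace (𝓡 D) x)]

/-- A partial diffeomorphism of class `C^n` is one of class `C^m` for every `m ≤ n`. -/
def PartialDiffeomorph.ofLE {E : Type*} [NormedAddCommGroup E] [NormedSpace ℝ E]
    {H : Type*} [TopologicalSpace H] {I : ModelWithCorners ℝ E H}
    {M : Type*} [TopologicalSpace M] [ChartedSpace H M]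
    {E' : Type*} [NormedAddCommGroup E'] [NormedSpace ℝ E']
    {H' : Type*} [TopologicalSpace H'] {I' : ModelWithCorners ℝ E' H'}
    {N : Type*} [TopologicalSpace N] [ChartedSpace H' N] {n m : WithTop ℕ∞}
    (Φ : PartialDiffeomorph I I' M N n) (h : m ≤ n) : PartialDiffeomorph I I' M N m where
  toPartialEquiv := Φ.toPartialEquiv
  open_source := Φ.open_source
  open_target := Φ.open_target
  contMDiffOn_toFun := Φ.contMDiffOn_toFun.of_le h
  contMDiffOn_invFun := Φ.contMDiffOn_invFun.of_le h

namespace Retraction.IsInvertibilityRadius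

variable {R : Retraction D M} {Δ : M → ℝ≥0∞}

lemma injOn_at (hΔ : R.IsInvertibilityRadius Δ) (x : M) :
    InjOn (R.at x) (tangentBall D x (Δ x)) := by
  obtain ⟨Φ, hs, hΦ⟩ := hΔ.diffeo
  intro u hu v hv h
  have hu' : (⟨x, u⟩ : TangentBundle (𝓡 D) M) ∈ tangentTube Δ := hu
  have hv' : (⟨x, v⟩ : TangentBundle (𝓡 D) M) ∈ tangentTube Δ := hv
  have h' : R.pairMap ⟨x, u⟩ = R.pairMap ⟨x, v⟩ := Prod.ext rfl h
  have := Φ.injOn (hs ▸ hu') (hs ▸ hv') ((hΦ hu').trans (h'.trans (hΦ hv').symm))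
  exact eq_of_heq (TotalSpace.mk.inj this).2

lemma inv_at (hΔ : R.IsInvertibilityRadius Δ) {x : M} {u : TangentSpace (𝓡 D) x}
    (hu : u ∈ tangentBall D x (Δ x)) : R.inv Δ x (R.at x u) = u :=
  (hΔ.injOn_at x).leftInvOn_invFunOn hu

/-- A retraction is bilipschitz in the fibers, on a third of an invertibility radius, uniformly on
compact sets on which this radius is finite. -/
lemma exists_bilipschitz [IsContMDiffRiemannianBundle (𝓡 D) ∞ (EuclideanSpace ℝ (Fin D))
      (fun x : M => TangentSpace (𝓡 D) x)] [IsRiemannianManifold (𝓡 D) M]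
    (hΔ : R.IsInvertibilityRadius Δ) {K : Set M} (hK : IsCompact K) (hΔK : ∀ x ∈ K, Δ x ≠ ⊤) :
    ∃ C : ℝ, 0 < C ∧ ∀ x ∈ K, ∀ u ∈ tangentBall D x (Δ x / 3), ∀ v ∈ tangentBall D x (Δ x / 3),
      dist (R.at x u) (R.at x v) ≤ C * ‖u - v‖ ∧ ‖u - v‖ ≤ C * dist (R.at x u) (R.at x v) := by
  have : IsContinuousRiemannianBundle (EuclideanSpace ℝ (Fin D))
    (fun x : M => TangentSpace (𝓡 D) x) := by
    obtain ⟨g, hg, h⟩ := IsContMDiffRiemannianBundle.exists_contMDiff (IB := 𝓡 D) (n := ∞)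
      (F := EuclideanSpace ℝ (Fin D)) (E := fun x : M => TangentSpace (𝓡 D) x)
    exact ⟨g, hg.continuous, h⟩
  obtain ⟨Φ, hs, hΦ⟩ := hΔ.diffeo
  -- Finiteness of `Δ` enters here: ⊤ / 3 = ⊤ in `ℝ≥0∞`. Strictness puts the closed tube of radius
  -- Δ/3 inside the open tube.
  have hlt : ∀ x ∈ K, Δ x / 3 < Δ x := fun x hx ↦
    ENNReal.div_lt_of_lt_mul (by
      simpa using ENNReal.mul_lt_mul_right (hΔ.pos x).ne' (hΔK x hx)
        (show (1 : ℝ≥0∞) < 3 by norm_num))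
  have hc : Continuous fun x ↦ Δ x / 3 := 
    (ENNReal.continuous_div_const 3 (by simp)).comp hΔ.continuous
  have hS := hK.tangentBundle_tube (I := 𝓡 D) hc fun x hx ↦ ((hlt x hx).trans_le le_top).ne
  obtain ⟨C, hC⟩ := (Φ.ofLE (m := 1) (by simp)).exists_fiberwise_bilipschitz (f := R.toFun)
    (fun a ha ↦ hΦ (hs ▸ ha)) hS (fun p hp ↦ by
      change p ∈ Φ.source
      rw [hs]
      exact hp.2.trans_lt (hlt _ hp.1))
  -- `C` may be 0, while a positive constant is required.
  refine ⟨C + 1, by positivity, fun x hx u hu v hv ↦ ?_⟩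
  have hu' : ‖u‖ₑ < Δ x / 3 := hu
  have hv' : ‖v‖ₑ < Δ x / 3 := hv
  obtain ⟨h₁, h₂⟩ := hC x u v ⟨hx, hu'.le⟩ ⟨hx, hv'.le⟩
  rw [edist_nndist, enorm_eq_nnnorm] at h₁ h₂
  have h₁ : dist (R.at x u) (R.at x v) ≤ C * ‖u - v‖ := by exact_mod_cast h₁
  have h₂ : ‖u - v‖ ≤ C * dist (R.at x u) (R.at x v) := by exact_mod_cast h₂
  constructor
  · refine h₁.trans ?_
    gcongr
    linarith
  · refine h₂.trans ?_
    gcongr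
    linarith

end Retraction.IsInvertibilityRadius

end Retraction

theorem lemma4p1 {D : ℕ} {M : Type*} [MetricSpace M] [ConnectedSpace M]
    [ChartedSpace (EuclideanSpace ℝ (Fin D)) M] [IsManifold (𝓡 D) ∞ M]
    [RiemannianBundle (fun x : M => TangentSpace (𝓡 D) x)]
    [IsContMDiffRiemannianBundle (𝓡 D) ∞ (EuclideanSpace ℝ (Fin D))
      (fun x : M => TangentSpace (𝓡 D) x)]
    [IsRiemannianManifold (𝓡 D) M]
    (R : Retraction D M) (Δ : M → ℝ≥0∞) (hΔ : R.IsInvertibilityRadius Δ) :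
    (∀ x : M, Δ x ≠ ⊤ →
      ∃ L_R : ℝ, 0 < L_R ∧ ∃ M_R : ℝ, 0 < M_R ∧
        (∀ u ∈ tangentBall D x (Δ x / 3), ∀ v ∈ tangentBall D x (Δ x / 3),
          dist (R.at x u) (R.at x v) ≤ L_R * ‖u - v‖) ∧
        (∀ y ∈ R.at x '' tangentBall D x (Δ x / 3), ∀ z ∈ R.at x '' tangentBall D x (Δ x / 3),
          ‖R.inv Δ x y - R.inv Δ x z‖ ≤ M_R * dist y z)) ∧
    (∀ K : Set M, IsCompact K → (∀ x ∈ K, Δ x ≠ ⊤) →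
      ∃ L_R : ℝ, 0 < L_R ∧ ∃ M_R : ℝ, 0 < M_R ∧ ∀ x ∈ K,
        (∀ u ∈ tangentBall D x (Δ x / 3), ∀ v ∈ tangentBall D x (Δ x / 3),
          dist (R.at x u) (R.at x v) ≤ L_R * ‖u - v‖) ∧
        (∀ y ∈ R.at x '' tangentBall D x (Δ x / 3), ∀ z ∈ R.at x '' tangentBall D x (Δ x / 3),
          ‖R.inv Δ x y - R.inv Δ x z‖ ≤ M_R * dist y z)) := by
  have key : ∀ K : Set M, IsCompact K → (∀ x ∈ K, Δ x ≠ ⊤) →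
      ∃ L_R : ℝ, 0 < L_R ∧ ∃ M_R : ℝ, 0 < M_R ∧ ∀ x ∈ K,
        (∀ u ∈ tangentBall D x (Δ x / 3), ∀ v ∈ tangentBall D x (Δ x / 3),
          dist (R.at x u) (R.at x v) ≤ L_R * ‖u - v‖) ∧
        (∀ y ∈ R.at x '' tangentBall D x (Δ x / 3), ∀ z ∈ R.at x '' tangentBall D x (Δ x / 3),
          ‖R.inv Δ x y - R.inv Δ x z‖ ≤ M_R * dist y z) := by
    intro K hK hΔK
    obtain ⟨C, C_pos, hC⟩ := hΔ.exists_bilipschitz hK hΔK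
    refine ⟨C, C_pos, C, C_pos, fun x hx ↦ ⟨fun u hu v hv ↦ (hC x hx u hu v hv).1, ?_⟩⟩
    -- Writing the two points as images of `u` and `v` turns (ii) into the lower bilipschitz bound,
    -- since `R.inv` recovers vectors of norm below `Δ x`.
    rintro _ ⟨u, hu, rfl⟩ _ ⟨v, hv, rfl⟩
    have hle : Δ x / 3 ≤ Δ x := ENNReal.div_le_of_le_mul (le_mul_of_one_le_right' (by norm_num))
    rw [hΔ.inv_at (lt_of_lt_of_le hu hle), hΔ.inv_at (lt_of_lt_of_le hv hle)]
    exact (hC x hx u hu v hv).2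
  refine ⟨fun x hx ↦ ?_, key⟩
  obtain ⟨L, hL, N, hN, h⟩ := key {x} isCompact_singleton (by simpa using hx)
  exact ⟨L, hL, N, hN, h x rfl⟩
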